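/- Theorem 4.1 (thm:untruthful-lb). Consider online learning with stochastic types over $T$ rounds, with a finite action set $A_i$, a finite type set $\Theta_i$ and the uniform prior $\rho_i$ on $\Theta_i$. In each round $t\in[T]$ the algorithm chooses a decision $\pi_i^t\in\Delta(A_i)^{\Theta_i}$ (possibly at random), depending only on the reward vectors $u_i^1,\dots,u_i^{t-1}\in[0,1]^{\Theta_i\times A_i}$ of the previous rounds (and on its own randomness), and then observes $u_i^t\in[0,1]^{\Theta_i\times A_i}$. Its untruthful swap regret is $$R_{\mathsf{US},i}^T=\max_{\psi\colon\Theta_i\to\Theta_i}\ \max_{\phi\colon\Theta_i\times A_i\to A_i}\ \sum_{t=1}^T\mathbb{E}_{\theta_i\sim\rho_i}\Bigl[\mathbb{E}_{a_i\sim\pi_i^t(\psi(\theta_i))}\bigl[u_i^t(\theta_i,\phi(\theta_i,a_i))\bigr]-\mathbb{E}_{a_i\sim\pi_i^t(\theta_i)}\bigl[u_i^t(\theta_i,a_i)\bigr]\Bigr].$$ Assume $|A_i|=2$, $|\Theta_i|=2^{B+1}$ for some $B\in\mathbb{Z}$, and that $T$ is a multiple of $B=\log_2|\Theta_i|-1$.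 If $T\ge 2^{-49}|\Theta_i|^2\log_2|\Theta_i|$, then for every randomized algorithm (that is, a deterministic algorithm chosen at random by means of a random seed; it may depend on $A_i,\Theta_i,\rho_i,T$) there exists an oblivious adversary, i.e. a fixed sequence of reward vectors $u_i^1,\dots,u_i^T\in[0,1]^{\Theta_i\times A_i}$ not depending on the algorithm's randomness, for which $$\mathbb{E}\bigl[R_{\mathsf{US},i}^T\bigr]\ \ge\ 2^{-28}\sqrt{T\log_2|\Theta_i|},$$ where the expectation is over the randomness of the algorithm. -/

import Mathlib

open MeasureTheory

noncomputable section

/-- A reward vector in `[0,1]^(Θ × A)`: a reward for every type and every action. -/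
abbrev RewardVector (Θ A : Type*) : Type _ := Θ → A → unitInterval

/-- A decision in `Δ(A)^Θ`: for every type, a probability distribution over the actions. -/
abbrev Decision (Θ A : Type*) [Fintype A] : Type _ := Θ → stdSimplex ℝ A

/-- The untruthful swap regret, for the prior `ρ`, the decisions `π 0, …, π (T - 1)` and the reward
vectors `u 0, …, u (T - 1)`: the maximum over `ψ : Θ → Θ` and `φ : Θ × A → A` of
`∑ₜ E_{θ ∼ ρ} [E_{a ∼ πᵗ(ψ θ)} [uᵗ(θ, φ(θ, a))] - E_{a ∼ πᵗ(θ)} [uᵗ(θ, a)]]`.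
The suprema are over finite nonempty sets, hence are maxima. -/
def untruthfulSwapRegret {Θ A : Type*} [Fintype Θ] [Fintype A] {T : ℕ} (ρ : stdSimplex ℝ Θ)
    (π : Fin T → Decision Θ A) (u : Fin T → RewardVector Θ A) : ℝ :=
  ⨆ ψ : Θ → Θ, ⨆ φ : Θ × A → A, ∑ t : Fin T, ∑ θ : Θ,
    ρ θ * ((∑ a : A, π t (ψ θ) a * (u t θ (φ (θ, a)) : ℝ)) - ∑ a : A, π t θ a * (u t θ a : ℝ))

/-- A deterministic algorithm over the horizon `T`: in each round it chooses its decision as a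
function of the reward vectors observed in all the previous rounds. -/
abbrev DetAlgorithm (Θ A : Type*) [Fintype A] (T : ℕ) : Type _ :=
  (t : Fin T) → (Fin t → RewardVector Θ A) → Decision Θ A

/-- The decisions made by a deterministic algorithm against the reward sequence `u`. -/
def DetAlgorithm.decisions {Θ A : Type*} [Fintype A] {T : ℕ} (D : DetAlgorithm Θ A T)
    (u : Fin T → RewardVector Θ A) : Fin T → Decision Θ A :=
  fun t => D t (fun s => u (Fin.castLE t.isLt.le s))

/-- A randomized algorithm over the horizon `T`: a deterministic algorithm chosen at random, by
means of a random seed `ω ∈ Ω`. -/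
structure RandomizedAlgorithm (Ω : Type*) [MeasurableSpace Ω] (Θ A : Type*) [Fintype A]
    (T : ℕ) where
  /-- The law of the seed. -/
  law : Measure Ω
  isProbabilityMeasure : IsProbabilityMeasure law
  /-- The deterministic algorithm which is run when the seed is `ω`. -/
  det : Ω → DetAlgorithm Θ A T
  /-- For each history, the decision is a random variable. -/
  measurable_det : ∀ (t : Fin T) (h : Fin t → RewardVector Θ A) (θ : Θ) (a : A),
    Measurable fun ω => (det ω t h θ a : ℝ)

/-- The (expected) untruthful swap regret of a randomized algorithm against the oblivious adversary
that plays the fixed reward sequence `u`. The expectation is over the randomness of the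
algorithm. -/
def RandomizedAlgorithm.expectedRegret {Ω : Type*} [MeasurableSpace Ω] {Θ A : Type*} [Fintype Θ]
    [Fintype A] {T : ℕ} (R : RandomizedAlgorithm Ω Θ A T) (ρ : stdSimplex ℝ Θ)
    (u : Fin T → RewardVector Θ A) : ℝ :=
  ∫ ω, untruthfulSwapRegret ρ ((R.det ω).decisions u) u ∂(R.law)

end

/-!
The regret is a maximum of linear functions of the decisions, so against a fixed reward sequence a
randomized algorithm does no better than the deterministic algorithm that plays its mean decisions
(`sum_le_expectedRegret`). Against the latter, the adversary splits the `2 ^ (B + 1)` types into two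
copies of the cube `{0, 1} ^ B`, the teachers and the students, and the `T` rounds into `B` blocks of
equal length `L`. A gain is the difference of the rewards of the two actions.

The gains of the teacher `b` in the block `k` favour the action `b k`, and their magnitude doubles
from block to block. As the bits of `b` are orthogonal on average, the constant deviation to the
action `b k` gains as much, if the rewards stop after the block `k`, as the whole magnitude of this
block, minus what the algorithm earned so far. So a small regret for every stopping time forces
the teachers, by a summation by parts with weights `2 ^ k`, to earn, relative to the uniform
decision, a constant fraction of what they would earn by following their bits `b k` in all rounds
of the game with gains of magnitude `1` (`le_sum_teacher`). The first block has magnitude about `1 / |Θ|`,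
and it is here that a lower bound for `T` of order `|Θ| ^ 2 log |Θ|` is used.

The students are matched with the teachers by a hidden random permutation `σ`, and the gains of the
student `w` are random signs, with a bias of order `1 / √L` towards those of the teacher `σ w`. Since
`σ` is a bijection, deviating to the decisions of the teachers earns the bias times a constant
fraction of the rounds, whatever the algorithm does. The students themselves earn less
(`sum_perm_le`): within a block the sign of the bias of `w` cannot be told from `L` samples, even if
all the rest of `σ` is known up to exchanging two teachers which differ only in the bit of this
block. The difference, `T / √L` up to a constant, is of order `√(T B)`
(`le_of_deviations_le`). Some realization of the random signs must then have a large regret. All the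
probabilities involved are finite sums over the discrete cube, with the densities `tilt`.
-/

noncomputable section

/-! ### Random signs on the discrete cube -/

/-- The sign `±1` encoded by a bit. -/
def sgn (b : Bool) : ℝ := if b then 1 else -1

@[simp] lemma sgn_true : sgn true = 1 := rfl

@[simp] lemma sgn_false : sgn false = -1 := rfl

lemma sgn_not (b : Bool) : sgn (!b) = -sgn b := by cases b <;> simp

lemma sgn_mul_self (b : Bool) : sgn b * sgn b = 1 := by cases b <;> simp

lemma abs_sgn (b : Bool) : |sgn b| = 1 := by cases b <;> simp

section Flip

variable {ι : Type*} [DecidableEq ι]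

/-- Negation of the coordinate `i` of a point of the discrete cube. -/
def flipBit (i : ι) (g : ι → Bool) : ι → Bool := Function.update g i (!g i)

@[simp] lemma flipBit_same (i : ι) (g : ι → Bool) : flipBit i g i = !g i := by simp [flipBit]

lemma flipBit_of_ne {i j : ι} (h : j ≠ i) (g : ι → Bool) : flipBit i g j = g j := by
  simp [flipBit, h]

lemma flipBit_flipBit (i : ι) (g : ι → Bool) : flipBit i (flipBit i g) = g := by
  funext j
  by_cases h : j = i
  · subst h; simp
  · simp [flipBit_of_ne h]

variable [Fintype ι]

/-- A function on the cube which is odd in one coordinate has sum zero. -/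
lemma sum_eq_zero_of_flipBit (i : ι) (f : (ι → Bool) → ℝ)
    (hf : ∀ g, f (flipBit i g) = -f g) : ∑ g, f g = 0 := by
  have h : ∑ g, f (flipBit i g) = ∑ g, f g :=
    Equiv.sum_comp (Function.Involutive.toPerm (flipBit i) (flipBit_flipBit i)) f
  simp only [hf, Finset.sum_neg_distrib] at h
  linarith

lemma sum_sgn_mul_sgn (i j : ι) :
    ∑ g : ι → Bool, sgn (g i) * sgn (g j) = if i = j then 2 ^ Fintype.card ι else 0 := by
  split_ifs with h
  · subst h
    simp [sgn_mul_self]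
  · apply sum_eq_zero_of_flipBit i
    intro g
    rw [flipBit_same, flipBit_of_ne (Ne.symm h), sgn_not]
    ring

end Flip

section Tilt

variable {ι : Type*} [Fintype ι]

/-- The density, with respect to the counting measure normalized by `2 ^ card ι`, of the law of
independent random signs with means `c i`. -/
def tilt (c : ι → ℝ) (g : ι → Bool) : ℝ := ∏ i, (1 + c i * sgn (g i))

lemma factor_nonneg {x : ℝ} (hx : |x| ≤ 1) (b : Bool) : 0 ≤ 1 + x * sgn b := by
  have := abs_le.1 hx
  cases b <;> simp <;> linarith

lemma tilt_nonneg {c : ι → ℝ} (hc : ∀ i, |c i| ≤ 1) (g : ι → Bool) : 0 ≤ tilt c g :=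
  Finset.prod_nonneg fun i _ => factor_nonneg (hc i) _

variable [DecidableEq ι]

lemma sum_prod_coord (f : ι → Bool → ℝ) :
    ∑ g : ι → Bool, ∏ i, f i (g i) = ∏ i, (f i true + f i false) := by
  have h := Finset.prod_univ_sum (fun _ : ι => (Finset.univ : Finset Bool)) f
  rw [Fintype.piFinset_univ] at h
  rw [← h]
  simp

lemma sum_tilt (c : ι → ℝ) : ∑ g, tilt c g = 2 ^ Fintype.card ι := by
  unfold tilt
  rw [sum_prod_coord (fun i b => 1 + c i * sgn b),
    Finset.prod_congr rfl (g := fun _ => (2 : ℝ)) (fun i _ => by simp; ring)]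
  simp

/-- Under the tilted law the sign `g i` has mean `c i` and is independent of every function of the
other coordinates. -/
lemma sum_tilt_mul_sgn (c : ι → ℝ) (i : ι) (f : (ι → Bool) → ℝ)
    (hf : ∀ g, f (flipBit i g) = f g) :
    ∑ g, tilt c g * (sgn (g i) * f g) = c i * ∑ g, tilt c g * f g := by
  rw [Finset.mul_sum, ← sub_eq_zero, ← Finset.sum_sub_distrib]
  apply sum_eq_zero_of_flipBit i
  intro g
  have key : ∀ g : ι → Bool, tilt c g =
      (1 + c i * sgn (g i)) * ∏ j ∈ Finset.univ.erase i, (1 + c j * sgn (g j)) := fun g =>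
    (Finset.mul_prod_erase Finset.univ _ (Finset.mem_univ i)).symm
  have hrest : ∏ j ∈ Finset.univ.erase i, (1 + c j * sgn (flipBit i g j)) =
      ∏ j ∈ Finset.univ.erase i, (1 + c j * sgn (g j)) :=
    Finset.prod_congr rfl fun j hj => by rw [flipBit_of_ne (Finset.ne_of_mem_erase hj)]
  rw [key g, key (flipBit i g), hrest, hf, flipBit_same, sgn_not]
  linear_combination (2 * c i * f g *
    ∏ j ∈ Finset.univ.erase i, (1 + c j * sgn (g j))) * sgn_mul_self (g i)

/-- Making the coordinates in `p` unbiased changes the tilted law by at most `ε` in `L¹`: this is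
the second moment (chi-squared) bound on the total variation distance. -/
lemma sum_abs_tilt_sub_le {c : ι → ℝ} (hc : ∀ i, |c i| ≤ 1) (p : ι → Prop) [DecidablePred p]
    {ε : ℝ} (hε : 0 < ε) (hP : ∏ i, (if p i then 1 + c i ^ 2 else 1) ≤ 1 + ε ^ 2) :
    ∑ g, |tilt c g - tilt (fun i => if p i then 0 else c i) g| ≤ ε * 2 ^ Fintype.card ι := by
  set c' : ι → ℝ := fun i => if p i then 0 else c i with hc'
  have hc'1 : ∀ i, |c' i| ≤ 1 := fun i => by
    by_cases h : p i <;> simp [hc', h, hc i]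
  set h : (ι → Bool) → ℝ := fun g => ∏ i, (if p i then 1 + c i * sgn (g i) else 1) with hh
  have h1 : ∀ g, tilt c g = tilt c' g * h g := fun g => by
    simp only [tilt, hh, ← Finset.prod_mul_distrib]
    refine Finset.prod_congr rfl fun i _ => ?_
    by_cases hp : p i <;> simp [hc', hp]
  have h2 : ∑ g, tilt c' g * h g ^ 2 ≤ 2 ^ Fintype.card ι * (1 + ε ^ 2) := by
    have e : ∀ g, tilt c' g * h g ^ 2 = ∏ i, (fun i b =>
        (1 + c' i * sgn b) * (if p i then 1 + c i * sgn b else 1) ^ 2) i (g i) := fun g => by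
      simp only [tilt, hh, ← Finset.prod_mul_distrib, ← Finset.prod_pow]
    rw [Finset.sum_congr rfl fun g _ => e g, sum_prod_coord (fun i b =>
        (1 + c' i * sgn b) * (if p i then 1 + c i * sgn b else 1) ^ 2)]
    have e2 : ∀ i, ((1 + c' i * sgn true) * (if p i then 1 + c i * sgn true else 1) ^ 2 +
        (1 + c' i * sgn false) * (if p i then 1 + c i * sgn false else 1) ^ 2) =
        2 * (if p i then 1 + c i ^ 2 else 1) := fun i => by
      by_cases hp : p i
      · simp [hc', hp]; ring
      · simp [hc', hp]; ring
    rw [Finset.prod_congr rfl fun i _ => e2 i, Finset.prod_mul_distrib]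
    simp only [Finset.prod_const, Finset.card_univ]
    gcongr
  -- The inequality `2 ε |x| ≤ x ^ 2 + ε ^ 2` stands in for the Cauchy-Schwarz inequality.
  have h3 : ∀ g, |tilt c g - tilt c' g| ≤
      (tilt c' g * h g ^ 2 - 2 * tilt c g + tilt c' g) / (2 * ε) + ε / 2 * tilt c' g := fun g => by
    have hn := tilt_nonneg hc'1 g
    rw [h1 g, show tilt c' g * h g - tilt c' g = tilt c' g * (h g - 1) by ring, abs_mul,
      abs_of_nonneg hn]
    have : |h g - 1| ≤ (h g - 1) ^ 2 / (2 * ε) + ε / 2 := by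
      rw [div_add_div _ _ (by positivity) (by norm_num), le_div_iff₀ (by positivity)]
      nlinarith [sq_nonneg (|h g - 1| - ε), sq_abs (h g - 1)]
    calc tilt c' g * |h g - 1| ≤ tilt c' g * ((h g - 1) ^ 2 / (2 * ε) + ε / 2) := by gcongr
      _ = _ := by ring
  refine (Finset.sum_le_sum fun g _ => h3 g).trans ?_
  rw [Finset.sum_add_distrib, ← Finset.sum_div, Finset.sum_add_distrib, Finset.sum_sub_distrib,
    ← Finset.mul_sum, ← Finset.mul_sum, sum_tilt, sum_tilt]
  have : (∑ g, tilt c' g * h g ^ 2 - 2 * 2 ^ Fintype.card ι + 2 ^ Fintype.card ι) / (2 * ε) ≤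
      ε / 2 * 2 ^ Fintype.card ι := by
    rw [div_le_iff₀ (by positivity)]
    nlinarith [h2]
  linarith

end Tilt

/-! ### Sums with doubling weights -/

/-- Summation by parts with weights `2 ^ j`. -/
lemma sum_range_eq_of_two_pow (a : ℕ → ℝ) (m : ℕ) :
    ∑ j ∈ Finset.range m, a j =
      ∑ k ∈ Finset.range m, (∑ j ∈ Finset.range (k + 1), 2 ^ j * a j) / 2 ^ (k + 1) +
        (∑ j ∈ Finset.range m, 2 ^ j * a j) / 2 ^ m := by
  induction m with
  | zero => simp
  | succ m ih =>
    rw [Finset.sum_range_succ, ih, Finset.sum_range_succ _ m, Finset.sum_range_succ _ m]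
    field_simp
    ring

/-- If every weighted partial sum is at least proportional to its last weight, then the unweighted
sum is at least proportional to its number of terms. -/
lemma le_sum_range_of_two_pow (a : ℕ → ℝ) {m : ℕ} (hm : 0 < m) {c d : ℝ} (hc : 0 ≤ c)
    (h : ∀ k < m, c * 2 ^ k - d ≤ ∑ j ∈ Finset.range (k + 1), 2 ^ j * a j) :
    c * m / 2 - d ≤ ∑ j ∈ Finset.range m, a j := by
  rw [sum_range_eq_of_two_pow]
  have h1 : ∀ n ≤ m, c * n / 2 - d * (1 - 1 / 2 ^ n) ≤
      ∑ k ∈ Finset.range n, (∑ j ∈ Finset.range (k + 1), 2 ^ j * a j) / 2 ^ (k + 1) := by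
    intro n
    induction n with
    | zero => simp
    | succ n ih =>
      intro hn
      rw [Finset.sum_range_succ]
      have := ih (by omega)
      have h2 : (c * 2 ^ n - d) / 2 ^ (n + 1) ≤
          (∑ j ∈ Finset.range (n + 1), 2 ^ j * a j) / 2 ^ (n + 1) := by
        gcongr
        exact h n (by omega)
      have h3 : (c * 2 ^ n - d) / 2 ^ (n + 1) = c / 2 - d * (1 / 2 ^ n) / 2 := by
        rw [pow_succ]
        field_simp
      have h4 : (1 : ℝ) / 2 ^ (n + 1) = (1 / 2 ^ n) / 2 := by field_simp; ring
      rw [h4]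
      push_cast
      linarith
  obtain ⟨k, rfl⟩ : ∃ k, m = k + 1 := ⟨m - 1, by omega⟩
  have h2 : (c * 2 ^ k - d) / 2 ^ (k + 1) ≤
      (∑ j ∈ Finset.range (k + 1), 2 ^ j * a j) / 2 ^ (k + 1) := by
    gcongr
    exact h k (by omega)
  have h3 : (c * 2 ^ k - d) / 2 ^ (k + 1) = c / 2 - d * (1 / 2 ^ (k + 1)) := by
    rw [pow_succ]
    field_simp
  have := h1 (k + 1) le_rfl
  linarith

/-! ### The adversary and the teachers -/

section Blocks

variable {B T : ℕ}

/-- The gains of the adversary which stops after `m` blocks, where the round `t` belongs to the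
block `blk t`. The types are two copies of the cube of bit vectors of length `B`. In the block `k`,
the gain of the teacher `Sum.inl b` has the sign encoded by the bit `b k` and a magnitude which
doubles from each block to the next, up to `1` in the last one. The gains of the students
`Sum.inr w` are the signs `g`. -/
def adversaryGain (blk : Fin T → Fin B) (g : (Fin B → Bool) × Fin T → Bool) (m : ℕ) (t : Fin T) :
    (Fin B → Bool) ⊕ (Fin B → Bool) → ℝ
  | .inl b => if (blk t : ℕ) < m then 2 ^ (blk t : ℕ) / 2 ^ (B - 1) * sgn (b (blk t)) else 0
  | .inr w => if (blk t : ℕ) < m then sgn (g (w, t)) else 0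

lemma abs_adversaryGain_le_one (blk : Fin T → Fin B) (g : (Fin B → Bool) × Fin T → Bool) (m : ℕ)
    (t : Fin T) (θ : (Fin B → Bool) ⊕ (Fin B → Bool)) : |adversaryGain blk g m t θ| ≤ 1 := by
  rcases θ with b | w
  · simp only [adversaryGain]
    split_ifs
    · rw [abs_mul, abs_sgn, mul_one, abs_of_nonneg (by positivity), div_le_one (by positivity)]
      exact pow_le_pow_right₀ (by norm_num) (by have := (blk t).isLt; omega)
    · simp
  · simp only [adversaryGain]
    split_ifs
    · rw [abs_sgn]
    · simp

lemma adversaryGain_eq_of_lt {blk : Fin T → Fin B} (hmono : Monotone blk)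
    (g : (Fin B → Bool) × Fin T → Bool) {m : ℕ} {t : Fin T} (ht : (blk t : ℕ) < m) {s : Fin T}
    (hs : s < t) : adversaryGain blk g m s = adversaryGain blk g B s := by
  have h : (blk s : ℕ) ≤ blk t := hmono hs.le
  funext θ
  rcases θ with b | w <;> simp [adversaryGain, h.trans_lt ht]

lemma adversaryGain_flipBit (blk : Fin T → Fin B) (g : (Fin B → Bool) × Fin T → Bool)
    (w : Fin B → Bool) {s t : Fin T} (hs : s < t) :
    adversaryGain blk (flipBit (w, t) g) B s = adversaryGain blk g B s := by
  funext θ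
  rcases θ with b | v
  · rfl
  · simp only [adversaryGain]
    rw [flipBit_of_ne]
    intro h
    exact hs.ne (congrArg Prod.snd h)

lemma sum_blocks {L : ℕ} {blk : Fin T → Fin B}
    (hcard : ∀ k, (Finset.univ.filter fun t => blk t = k).card = L) : (T : ℝ) = B * L := by
  have h := Finset.card_eq_sum_card_fiberwise (f := blk) (s := Finset.univ) (t := Finset.univ)
    (fun _ _ => Finset.mem_coe.2 (Finset.mem_univ _))
  simp only [hcard] at h
  simp at h
  exact_mod_cast h

/-- If no constant deviation, after any number of blocks, gains the teachers more than `R`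
altogether, then the teachers follow their bits on average. On average over the teachers `b`, the
gains before the block `k` are uncorrelated with the bit `b k`, so the constant action encoded by
`b k` earns the full magnitude of the block `k`, which the teachers have to match. -/
lemma le_sum_teacher {L : ℕ} (hB : 0 < B) {blk : Fin T → Fin B} (hmono : Monotone blk)
    (hcard : ∀ k, (Finset.univ.filter fun t => blk t = k).card = L)
    {Z : (Fin T → (Fin B → Bool) ⊕ (Fin B → Bool) → ℝ) →
      Fin T → (Fin B → Bool) ⊕ (Fin B → Bool) → ℝ}
    (hcausal : ∀ G G' t, (∀ s < t, G s = G' s) → Z G t = Z G' t) {R : ℝ}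
    (hconst : ∀ G, (∀ t θ, |G t θ| ≤ 1) → ∀ s : (Fin B → Bool) → Bool,
      ∑ b, ∑ t, G t (.inl b) * (sgn (s b) - Z G t (.inl b)) ≤ R)
    (g : (Fin B → Bool) × Fin T → Bool) :
    2 ^ B * T / 2 - 2 ^ (B - 1) * R ≤
      ∑ b : Fin B → Bool, ∑ t, sgn (b (blk t)) * Z (adversaryGain blk g B) t (.inl b) := by
  set x : Fin T → ℝ := fun t =>
    ∑ b : Fin B → Bool, sgn (b (blk t)) * Z (adversaryGain blk g B) t (.inl b) with hx
  have hT := sum_blocks hcard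
  have key := le_sum_range_of_two_pow
    (fun j => ∑ t, if (blk t : ℕ) = j then x t else 0) hB
    (c := 2 ^ B * L) (d := 2 ^ (B - 1) * R) (by positivity) ?_
  · rw [Finset.sum_comm] at key
    simp only [Finset.sum_ite_eq, Finset.mem_range, Fin.is_lt, if_true] at key
    rw [Finset.sum_comm]
    rw [hT]
    linarith
  intro k hk
  -- Up to the block `k` the algorithm sees the same gains as if the game went on.
  have h1 := hconst (adversaryGain blk g (k + 1)) (abs_adversaryGain_le_one _ _ _)
    (fun b => b ⟨k, hk⟩)
  have e1 : ∀ (b : Fin B → Bool) (t : Fin T), adversaryGain blk g (k + 1) t (.inl b) *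
      (sgn (b ⟨k, hk⟩) - Z (adversaryGain blk g (k + 1)) t (.inl b)) =
      (if (blk t : ℕ) < k + 1 then 2 ^ (blk t : ℕ) / 2 ^ (B - 1) else 0) *
        (sgn (b (blk t)) * sgn (b ⟨k, hk⟩) -
          sgn (b (blk t)) * Z (adversaryGain blk g B) t (.inl b)) := by
    intro b t
    by_cases ht : (blk t : ℕ) < k + 1
    · rw [hcausal _ (adversaryGain blk g B) t fun s hs => adversaryGain_eq_of_lt hmono g ht hs]
      simp only [adversaryGain, ht, if_true]
      ring
    · simp [adversaryGain, ht]
  simp only [e1] at h1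
  rw [Finset.sum_comm] at h1
  simp only [← Finset.mul_sum, Finset.sum_sub_distrib, sum_sgn_mul_sgn, Fintype.card_fin] at h1
  have e2 : ∑ j ∈ Finset.range (k + 1), 2 ^ j * ∑ t, (if (blk t : ℕ) = j then x t else 0) =
      ∑ t, (if (blk t : ℕ) < k + 1 then 2 ^ (blk t : ℕ) * x t else 0) := by
    simp only [Finset.mul_sum]
    rw [Finset.sum_comm]
    refine Finset.sum_congr rfl fun t _ => ?_
    simp
  have e3 : ∀ t, (if (blk t : ℕ) < k + 1 then (2 : ℝ) ^ (blk t : ℕ) / 2 ^ (B - 1) else 0) *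
      ((if blk t = ⟨k, hk⟩ then 2 ^ B else 0) - x t) =
      ((if blk t = ⟨k, hk⟩ then 2 ^ k * 2 ^ B else 0) -
        (if (blk t : ℕ) < k + 1 then 2 ^ (blk t : ℕ) * x t else 0)) / 2 ^ (B - 1) := by
    intro t
    by_cases h : blk t = ⟨k, hk⟩
    · simp [h]; ring
    · by_cases h' : (blk t : ℕ) < k + 1 <;> simp [h, h'] ; ring
  rw [Finset.sum_congr rfl fun t _ => e3 t, ← Finset.sum_div, Finset.sum_sub_distrib,
    Finset.sum_ite, Finset.sum_const_zero, Finset.sum_const, hcard, ← e2,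
    div_le_iff₀ (by positivity)] at h1
  simp only [nsmul_eq_mul, add_zero] at h1
  linarith

/-! ### The students -/

/-- The means of the signs of the students, when the student `w` is assigned the hidden teacher
`σ w`: a bias `δ` towards the sign that the teacher's gains have. -/
def bias (blk : Fin T → Fin B) (δ : ℝ) (σ : Equiv.Perm (Fin B → Bool))
    (p : (Fin B → Bool) × Fin T) : ℝ :=
  δ * sgn (σ p.1 (blk p.2))

/-- The permutation `σ`, with the values `σ w` and `flipBit k (σ w)` exchanged. -/
def exchange (w : Fin B → Bool) (k : Fin B) (σ : Equiv.Perm (Fin B → Bool)) :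
    Equiv.Perm (Fin B → Bool) :=
  Equiv.swap (σ w) (flipBit k (σ w)) * σ

lemma exchange_apply_self (w : Fin B → Bool) (k : Fin B) (σ : Equiv.Perm (Fin B → Bool)) :
    exchange w k σ w = flipBit k (σ w) := by
  simp [exchange]

lemma exchange_exchange (w : Fin B → Bool) (k : Fin B) (σ : Equiv.Perm (Fin B → Bool)) :
    exchange w k (exchange w k σ) = σ := by
  conv_lhs => rw [exchange, exchange_apply_self, flipBit_flipBit, exchange]
  rw [← mul_assoc, Equiv.swap_comm, Equiv.swap_mul_self, one_mul]

lemma exchange_apply_of_ne (w v : Fin B → Bool) {k j : Fin B} (σ : Equiv.Perm (Fin B → Bool))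
    (h : j ≠ k) : exchange w k σ v j = σ v j := by
  simp only [exchange, Equiv.Perm.mul_apply, Equiv.swap_apply_def]
  split_ifs with h1 h2
  · rw [flipBit_of_ne h, h1]
  · rw [h2, flipBit_of_ne h]
  · rfl

lemma exchange_apply_of_not (w v : Fin B → Bool) {k : Fin B} (σ : Equiv.Perm (Fin B → Bool))
    (h : ¬ ∀ j, j ≠ k → σ v j = σ w j) : exchange w k σ v = σ v := by
  simp only [exchange, Equiv.Perm.mul_apply]
  refine Equiv.swap_apply_of_ne_of_ne (fun h' => h fun j _ => by rw [h']) fun h' => h fun j hj => ?_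
  rw [h', flipBit_of_ne hj]

/-- The student `w` cannot tell, within the block `k`, its hidden sign `σ w k`: exchanging its
teacher with the one which differs in the bit `k` only affects the signs of two students in this
block, and these are too weakly biased to be distinguished from unbiased ones. -/
lemma sum_perm_le {L : ℕ} {blk : Fin T → Fin B}
    (hcard : ∀ k, (Finset.univ.filter fun t => blk t = k).card = L)
    {δ : ℝ} (hδ0 : 0 ≤ δ) (hδ1 : δ ≤ 1) {ε : ℝ} (hε : 0 < ε)
    (hδε : (1 + δ ^ 2) ^ (2 * L) ≤ 1 + ε ^ 2)
    (w : Fin B → Bool) (k : Fin B) {X : ((Fin B → Bool) × Fin T → Bool) → ℝ} {c : ℝ}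
    (hX : ∀ g, |X g| ≤ c) :
    ∑ σ : Equiv.Perm (Fin B → Bool), sgn (σ w k) * ∑ g, tilt (bias blk δ σ) g * X g ≤
      Fintype.card (Equiv.Perm (Fin B → Bool)) *
        (ε * 2 ^ Fintype.card ((Fin B → Bool) × Fin T) * c) := by
  set p : Equiv.Perm (Fin B → Bool) → (Fin B → Bool) × Fin T → Prop := fun σ q =>
    blk q.2 = k ∧ ∀ j, j ≠ k → σ q.1 j = σ w j with hp
  -- The biases without those of `w` and of the student exchanged with it, within the block `k`.
  set neutral : Equiv.Perm (Fin B → Bool) → (Fin B → Bool) × Fin T → ℝ := fun σ q =>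
    if p σ q then 0 else bias blk δ σ q with hneutral
  have hbias : ∀ σ q, |bias blk δ σ q| ≤ 1 := fun σ q => by
    rw [bias, abs_mul, abs_sgn, mul_one, abs_of_nonneg hδ0]
    exact hδ1
  have hinv : ∀ σ, neutral (exchange w k σ) = neutral σ := fun σ => by
    funext q
    have hpq : p (exchange w k σ) q ↔ p σ q := by
      refine and_congr_right fun _ => forall_congr' fun j => imp_congr_right fun hj => ?_
      rw [exchange_apply_of_ne _ _ _ hj, exchange_apply_of_ne _ _ _ hj]
    by_cases h : p σ q
    · simp [hneutral, h, hpq]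
    · simp only [hneutral, h, hpq, if_false, bias]
      by_cases hq : blk q.2 = k
      · rw [exchange_apply_of_not _ _ _ fun h' => h ⟨hq, h'⟩]
      · rw [exchange_apply_of_ne _ _ _ hq]
  have hzero : ∑ σ : Equiv.Perm (Fin B → Bool), sgn (σ w k) * ∑ g, tilt (neutral σ) g * X g = 0 := by
    have h : ∑ σ : Equiv.Perm (Fin B → Bool), sgn (exchange w k σ w k) *
        ∑ g, tilt (neutral (exchange w k σ)) g * X g =
        ∑ σ : Equiv.Perm (Fin B → Bool), sgn (σ w k) * ∑ g, tilt (neutral σ) g * X g :=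
      Equiv.sum_comp (Function.Involutive.toPerm (exchange w k) (exchange_exchange w k))
        (fun σ => sgn (σ w k) * ∑ g, tilt (neutral σ) g * X g)
    simp only [hinv, exchange_apply_self, flipBit_same, sgn_not, neg_mul,
      Finset.sum_neg_distrib] at h
    linarith
  have hclose : ∀ σ, ∑ g, |tilt (bias blk δ σ) g - tilt (neutral σ) g| ≤
      ε * 2 ^ Fintype.card ((Fin B → Bool) × Fin T) := fun σ => by
    refine sum_abs_tilt_sub_le (hbias σ) (p σ) hε (le_trans ?_ hδε)
    have hsq : ∀ q, (if p σ q then 1 + bias blk δ σ q ^ 2 else 1) =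
        if p σ q then 1 + δ ^ 2 else 1 := fun q => by
      rw [bias, mul_pow, sq (sgn _), sgn_mul_self, mul_one]
    rw [Finset.prod_congr rfl fun q _ => hsq q, Finset.prod_ite, Finset.prod_const,
      Finset.prod_const_one, mul_one]
    refine pow_le_pow_right₀ (by nlinarith [sq_nonneg δ]) ?_
    have hsub : Finset.univ.filter (p σ) ⊆
        ({w, σ.symm (flipBit k (σ w))} : Finset (Fin B → Bool)) ×ˢ
          (Finset.univ.filter fun t => blk t = k) := by
      intro q hq
      have hq := (Finset.mem_filter.1 hq).2
      refine Finset.mem_product.2 ⟨?_, Finset.mem_filter.2 ⟨Finset.mem_univ _, hq.1⟩⟩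
      rw [Finset.mem_insert, Finset.mem_singleton, Equiv.eq_symm_apply]
      by_cases h : σ q.1 k = σ w k
      · left
        apply σ.injective
        funext j
        by_cases hj : j = k
        · rw [hj, h]
        · exact hq.2 j hj
      · right
        funext j
        by_cases hj : j = k
        · rw [hj, flipBit_same]
          exact Bool.eq_not.2 h
        · rw [flipBit_of_ne hj]
          exact hq.2 j hj
    refine (Finset.card_le_card hsub).trans ?_
    rw [Finset.card_product, hcard]
    exact Nat.mul_le_mul_right _ Finset.card_le_two
  rw [← sub_zero (∑ σ : Equiv.Perm (Fin B → Bool), _), ← hzero, ← Finset.sum_sub_distrib,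
    ← nsmul_eq_mul, ← Finset.card_univ, ← Finset.sum_const]
  refine Finset.sum_le_sum fun σ _ => ?_
  rw [← mul_sub, ← Finset.sum_sub_distrib]
  have hc : 0 ≤ c := (abs_nonneg _).trans (hX fun _ => true)
  calc sgn (σ w k) * ∑ g, (tilt (bias blk δ σ) g * X g - tilt (neutral σ) g * X g)
      ≤ |sgn (σ w k) * ∑ g, (tilt (bias blk δ σ) g * X g - tilt (neutral σ) g * X g)| :=
        le_abs_self _
    _ ≤ ∑ g, |tilt (bias blk δ σ) g * X g - tilt (neutral σ) g * X g| := by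
        rw [abs_mul, abs_sgn, one_mul]
        exact Finset.abs_sum_le_sum_abs _ _
    _ ≤ ∑ g, |tilt (bias blk δ σ) g - tilt (neutral σ) g| * c := by
        refine Finset.sum_le_sum fun g _ => ?_
        rw [← sub_mul, abs_mul]
        gcongr
        exact hX g
    _ ≤ _ := by
        rw [← Finset.sum_mul]
        gcongr
        exact hclose σ

/-! ### Deviations against a deterministic algorithm -/

/-- A lower bound for the best deviation against the mean decisions `Z`, written in terms of the
difference of the probabilities of the two actions. Here `hconst` concerns the constant deviations
of the teachers, and `htype` the deviations of the students to the types of teachers. -/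
lemma le_of_deviations_le {L : ℕ} (hB : 0 < B) {blk : Fin T → Fin B} (hmono : Monotone blk)
    (hcard : ∀ k, (Finset.univ.filter fun t => blk t = k).card = L)
    {Z : (Fin T → (Fin B → Bool) ⊕ (Fin B → Bool) → ℝ) →
      Fin T → (Fin B → Bool) ⊕ (Fin B → Bool) → ℝ}
    (hcausal : ∀ G G' t, (∀ s < t, G s = G' s) → Z G t = Z G' t)
    (hZ : ∀ G t θ, |Z G t θ| ≤ 1) {R : ℝ}
    (hconst : ∀ G, (∀ t θ, |G t θ| ≤ 1) → ∀ s : (Fin B → Bool) → Bool,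
      ∑ b, ∑ t, G t (.inl b) * (sgn (s b) - Z G t (.inl b)) ≤ R)
    (htype : ∀ G, (∀ t θ, |G t θ| ≤ 1) → ∀ σ : (Fin B → Bool) → (Fin B → Bool),
      ∑ w, ∑ t, G t (.inr w) * (Z G t (.inl (σ w)) - Z G t (.inr w)) ≤ R)
    {δ : ℝ} (hδ0 : 0 ≤ δ) (hδ1 : δ ≤ 1) {ε : ℝ} (hε : 0 < ε)
    (hδε : (1 + δ ^ 2) ^ (2 * L) ≤ 1 + ε ^ 2) :
    δ * (2 ^ B * T / 2 - 2 ^ (B - 1) * R - ε * 2 ^ B * T) ≤ R := by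
  set z : ((Fin B → Bool) × Fin T → Bool) → Fin T → (Fin B → Bool) ⊕ (Fin B → Bool) → ℝ :=
    fun g => Z (adversaryGain blk g B) with hz
  set M : ℝ := 2 ^ Fintype.card ((Fin B → Bool) × Fin T) with hM
  set C : ℝ := 2 ^ B * T / 2 - 2 ^ (B - 1) * R with hC
  have hMpos : 0 < M := by positivity
  have hT := sum_blocks hcard
  set own : Equiv.Perm (Fin B → Bool) → ℝ := fun σ =>
    ∑ w, ∑ t, sgn (σ w (blk t)) * ∑ g, tilt (bias blk δ σ) g * z g t (.inr w) with hown
  have hbias : ∀ σ q, |bias blk δ σ q| ≤ 1 := fun σ q => by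
    rw [bias, abs_mul, abs_sgn, mul_one, abs_of_nonneg hδ0]
    exact hδ1
  -- For each matching `σ`, the bound `htype` is averaged over the law of the biased signs.
  have h1 : ∀ σ, δ * (C * M - own σ) ≤ R * M := fun σ => by
    have hteach : C * M ≤ ∑ w, ∑ t, sgn (σ w (blk t)) *
        ∑ g, tilt (bias blk δ σ) g * z g t (.inl (σ w)) := by
      have e : ∑ w, ∑ t, sgn (σ w (blk t)) *
          ∑ g, tilt (bias blk δ σ) g * z g t (.inl (σ w)) =
          ∑ g, tilt (bias blk δ σ) g * ∑ b : Fin B → Bool, ∑ t, sgn (b (blk t)) * z g t (.inl b) := by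
        rw [Equiv.sum_comp σ fun b => ∑ t, sgn (b (blk t)) *
          ∑ g, tilt (bias blk δ σ) g * z g t (.inl b)]
        simp only [Finset.mul_sum]
        rw [Finset.sum_comm (s := (Finset.univ : Finset ((Fin B → Bool) × Fin T → Bool)))]
        refine Finset.sum_congr rfl fun b _ => ?_
        rw [Finset.sum_comm]
        exact Finset.sum_congr rfl fun g _ => Finset.sum_congr rfl fun t _ => by ring
      rw [e, hM, ← sum_tilt (bias blk δ σ), Finset.mul_sum]
      refine Finset.sum_le_sum fun g _ => ?_
      rw [mul_comm C]
      exact mul_le_mul_of_nonneg_left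
        (le_sum_teacher hB hmono hcard hcausal hconst g) (tilt_nonneg (hbias σ) g)
    have hdev : ∑ w, ∑ t, ∑ g, tilt (bias blk δ σ) g *
        (sgn (g (w, t)) * (z g t (.inl (σ w)) - z g t (.inr w))) ≤ R * M := by
      rw [hM, ← sum_tilt (bias blk δ σ), Finset.mul_sum]
      have e : ∑ w, ∑ t, ∑ g, tilt (bias blk δ σ) g *
          (sgn (g (w, t)) * (z g t (.inl (σ w)) - z g t (.inr w))) =
          ∑ g, tilt (bias blk δ σ) g * ∑ w, ∑ t,
            sgn (g (w, t)) * (z g t (.inl (σ w)) - z g t (.inr w)) := by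
        simp only [Finset.mul_sum]
        rw [Finset.sum_comm (s := (Finset.univ : Finset ((Fin B → Bool) × Fin T → Bool)))]
        exact Finset.sum_congr rfl fun w _ => Finset.sum_comm
      rw [e]
      refine Finset.sum_le_sum fun g _ => ?_
      rw [mul_comm R]
      refine mul_le_mul_of_nonneg_left ?_ (tilt_nonneg (hbias σ) g)
      simpa [adversaryGain] using htype (adversaryGain blk g B) (abs_adversaryGain_le_one _ _ _) σ
    have hswap : ∀ w t, ∑ g, tilt (bias blk δ σ) g *
        (sgn (g (w, t)) * (z g t (.inl (σ w)) - z g t (.inr w))) =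
        δ * (sgn (σ w (blk t)) * ∑ g, tilt (bias blk δ σ) g * z g t (.inl (σ w)) -
          sgn (σ w (blk t)) * ∑ g, tilt (bias blk δ σ) g * z g t (.inr w)) := fun w t => by
      rw [sum_tilt_mul_sgn _ (w, t) (fun g => z g t (.inl (σ w)) - z g t (.inr w))]
      · simp only [bias, mul_sub, Finset.sum_sub_distrib]
        ring
      · intro g
        simp only [hz]
        rw [hcausal _ _ t fun s hs => adversaryGain_flipBit blk g w hs]
    simp only [hswap, ← Finset.mul_sum, Finset.sum_sub_distrib] at hdev
    exact (mul_le_mul_of_nonneg_left (sub_le_sub_right hteach _) hδ0).trans hdev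
  have h2 : ∑ σ, own σ ≤
      Fintype.card (Equiv.Perm (Fin B → Bool)) * (ε * M * (2 ^ B * T)) := by
    have e : ∑ σ, own σ = ∑ w, ∑ k, ∑ σ : Equiv.Perm (Fin B → Bool), sgn (σ w k) *
        ∑ g, tilt (bias blk δ σ) g * ∑ t with blk t = k, z g t (.inr w) := by
      simp only [hown]
      rw [Finset.sum_comm]
      refine Finset.sum_congr rfl fun w _ => ?_
      rw [Finset.sum_comm (s := (Finset.univ : Finset (Fin B)))]
      refine Finset.sum_congr rfl fun σ _ => ?_
      rw [← Finset.sum_fiberwise _ blk]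
      refine Finset.sum_congr rfl fun k _ => ?_
      simp only [Finset.mul_sum]
      rw [Finset.sum_comm]
      refine Finset.sum_congr rfl fun g _ => Finset.sum_congr rfl fun t ht => ?_
      rw [(Finset.mem_filter.1 ht).2]
    rw [e]
    calc _ ≤ ∑ _w : Fin B → Bool, ∑ _k : Fin B,
          (Fintype.card (Equiv.Perm (Fin B → Bool)) : ℝ) * (ε * M * L) := by
          refine Finset.sum_le_sum fun w _ => Finset.sum_le_sum fun k _ => ?_
          refine sum_perm_le hcard hδ0 hδ1 hε hδε w k fun g => ?_
          calc _ ≤ ∑ t with blk t = k, |z g t (.inr w)| := Finset.abs_sum_le_sum_abs _ _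
            _ ≤ ∑ t with blk t = k, (1 : ℝ) := Finset.sum_le_sum fun t _ => hZ _ _ _
            _ = L := by simp [hcard]
      _ = _ := by
          simp [hT]
          ring
  have h3 : ∑ σ : Equiv.Perm (Fin B → Bool), δ * (C * M - own σ) ≤
      ∑ _σ : Equiv.Perm (Fin B → Bool), R * M := Finset.sum_le_sum fun σ _ => h1 σ
  rw [← Finset.mul_sum, Finset.sum_sub_distrib, Finset.sum_const, Finset.sum_const, nsmul_eq_mul,
    nsmul_eq_mul, Finset.card_univ] at h3
  set P : ℝ := (Fintype.card (Equiv.Perm (Fin B → Bool)) : ℝ) with hP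
  have hPpos : 0 < P := by
    rw [hP]
    exact_mod_cast Fintype.card_pos
  have h4 : δ * (P * (C * M) - P * (ε * M * (2 ^ B * T))) ≤ P * (R * M) :=
    (mul_le_mul_of_nonneg_left (sub_le_sub_left h2 _) hδ0).trans h3
  have h5 : (P * M) * (δ * (C - ε * 2 ^ B * T)) ≤ (P * M) * R := by linarith
  exact le_of_mul_le_mul_left h5 (by positivity)

end Blocks

/-! ### Regret against the mean decisions -/

section Game

variable {Θ A : Type*}

/-- The reward vectors for two actions, told apart by `e`, whose rewards are symmetric about `1/2`
and differ by the gain `G`. For gains outside `[-1, 1]` the rewards are truncated. -/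
def rewardOfGain {T : ℕ} (e : A → Bool) (G : Fin T → Θ → ℝ) : Fin T → RewardVector Θ A :=
  fun t θ a => Set.projIcc 0 1 zero_le_one ((1 + sgn (e a) * G t θ) / 2)

lemma coe_rewardOfGain {T : ℕ} (e : A → Bool) {G : Fin T → Θ → ℝ} (hG : ∀ t θ, |G t θ| ≤ 1)
    (t : Fin T) (θ : Θ) (a : A) :
    (rewardOfGain e G t θ a : ℝ) = (1 + sgn (e a) * G t θ) / 2 := by
  have h := abs_le.1 (hG t θ)
  rw [rewardOfGain, Set.projIcc_of_mem]
  cases e a <;> simp <;> constructor <;> linarith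

variable [Fintype A]

lemma sum_mul_mem_unitInterval (p : stdSimplex ℝ A) (f : A → unitInterval) :
    0 ≤ ∑ a, p a * (f a : ℝ) ∧ ∑ a, p a * (f a : ℝ) ≤ 1 := by
  refine ⟨Finset.sum_nonneg fun a _ => mul_nonneg (p.2.1 a) (f a).2.1, ?_⟩
  calc _ ≤ ∑ a, p a := Finset.sum_le_sum fun a _ => mul_le_of_le_one_right (p.2.1 a) (f a).2.2
    _ = 1 := p.2.2

/-- The difference of the probabilities of the two actions, told apart by `e`. -/
def advantage (e : A → Bool) (p : stdSimplex ℝ A) : ℝ := ∑ a, sgn (e a) * p a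

lemma abs_advantage_le_one (e : A → Bool) (p : stdSimplex ℝ A) : |advantage e p| ≤ 1 := by
  refine (Finset.abs_sum_le_sum_abs _ _).trans (le_of_eq ?_)
  rw [← (p.2.2 : ∑ a, p a = 1)]
  refine Finset.sum_congr rfl fun a _ => ?_
  rw [abs_mul, abs_sgn, one_mul, abs_of_nonneg (show 0 ≤ p a from p.2.1 a)]
  rfl

lemma sum_mul_gain (e : A → Bool) (p : stdSimplex ℝ A) (x : ℝ) :
    ∑ a, p a * ((1 + sgn (e a) * x) / 2) = 1 / 2 + x * advantage e p / 2 := by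
  have h : ∑ a, p a = 1 := p.2.2
  calc _ = ∑ a, (p a * (1 / 2) + sgn (e a) * p a * (x / 2)) :=
        Finset.sum_congr rfl fun a _ => by ring
    _ = _ := by
        rw [Finset.sum_add_distrib, ← Finset.sum_mul, ← Finset.sum_mul, h, advantage]
        ring

/-- The advantage after a deviation of the type `θ`: to the constant action `κ θ` if there is one,
and to the decision for the type `ψ θ` otherwise. -/
def deviation (κ : Θ → Option Bool) (ψ : Θ → Θ) (x : Θ → ℝ) (θ : Θ) : ℝ :=
  (κ θ).elim (x (ψ θ)) sgn

/-- The advantages of the mean decisions of a randomized algorithm. -/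
def meanAdvantage {T : ℕ} {Ω : Type*} [MeasurableSpace Ω] (R : RandomizedAlgorithm Ω Θ A T)
    (e : A → Bool) (u : Fin T → RewardVector Θ A) (t : Fin T) (θ : Θ) : ℝ :=
  ∫ ω, advantage e ((R.det ω).decisions u t θ) ∂(R.law)

lemma integrable_advantage {T : ℕ} {Ω : Type*} [MeasurableSpace Ω]
    (R : RandomizedAlgorithm Ω Θ A T) (e : A → Bool) (u : Fin T → RewardVector Θ A) (t : Fin T)
    (θ : Θ) : Integrable (fun ω => advantage e ((R.det ω).decisions u t θ)) R.law := by
  have := R.isProbabilityMeasure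
  refine Integrable.of_bound (Measurable.aestronglyMeasurable ?_) 1
    (Filter.Eventually.of_forall fun ω => abs_advantage_le_one _ _)
  exact Finset.measurable_sum _ fun a _ => (R.measurable_det t _ θ a).const_mul _

lemma abs_meanAdvantage_le_one {T : ℕ} {Ω : Type*} [MeasurableSpace Ω]
    (R : RandomizedAlgorithm Ω Θ A T) (e : A → Bool) (u : Fin T → RewardVector Θ A) (t : Fin T)
    (θ : Θ) : |meanAdvantage R e u t θ| ≤ 1 := by
  have := R.isProbabilityMeasure
  have h := norm_integral_le_of_norm_le_const (μ := R.law) (C := 1)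
    (f := fun ω => advantage e ((R.det ω).decisions u t θ)) (Filter.Eventually.of_forall fun ω =>
      abs_advantage_le_one e ((R.det ω).decisions u t θ))
  simpa [meanAdvantage] using h

lemma meanAdvantage_congr {T : ℕ} {Ω : Type*} [MeasurableSpace Ω]
    (R : RandomizedAlgorithm Ω Θ A T) (e : A → Bool) {u u' : Fin T → RewardVector Θ A} {t : Fin T}
    (h : ∀ s < t, u s = u' s) (θ : Θ) : meanAdvantage R e u t θ = meanAdvantage R e u' t θ := by
  have : (fun s : Fin t => u (Fin.castLE t.isLt.le s)) =
      fun s : Fin t => u' (Fin.castLE t.isLt.le s) :=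
    funext fun s => h _ (Fin.lt_def.2 s.isLt)
  simp only [meanAdvantage, DetAlgorithm.decisions, this]

variable [Fintype Θ]

lemma le_untruthfulSwapRegret {T : ℕ} (ρ : stdSimplex ℝ Θ) (π : Fin T → Decision Θ A)
    (u : Fin T → RewardVector Θ A) (ψ : Θ → Θ) (φ : Θ × A → A) :
    ∑ t : Fin T, ∑ θ : Θ, ρ θ * ((∑ a : A, π t (ψ θ) a * (u t θ (φ (θ, a)) : ℝ)) -
      ∑ a : A, π t θ a * (u t θ a : ℝ)) ≤ untruthfulSwapRegret ρ π u := by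
  unfold untruthfulSwapRegret
  exact le_ciSup_of_le (Set.finite_range _).bddAbove ψ
    (le_ciSup_of_le (Set.finite_range _).bddAbove φ le_rfl)

lemma untruthfulSwapRegret_nonneg {T : ℕ} (ρ : stdSimplex ℝ Θ) (π : Fin T → Decision Θ A)
    (u : Fin T → RewardVector Θ A) : 0 ≤ untruthfulSwapRegret ρ π u := by
  simpa using le_untruthfulSwapRegret ρ π u id Prod.snd

lemma untruthfulSwapRegret_le [Nonempty Θ] [Nonempty A] {T : ℕ} (ρ : stdSimplex ℝ Θ)
    (π : Fin T → Decision Θ A) (u : Fin T → RewardVector Θ A) :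
    untruthfulSwapRegret ρ π u ≤ T := by
  unfold untruthfulSwapRegret
  refine ciSup_le fun ψ => ciSup_le fun φ => ?_
  calc _ ≤ ∑ _t : Fin T, ∑ θ : Θ, ρ θ := by
        refine Finset.sum_le_sum fun t _ => Finset.sum_le_sum fun θ _ => ?_
        refine mul_le_of_le_one_right (ρ.2.1 θ) ?_
        have h1 := (sum_mul_mem_unitInterval (π t (ψ θ)) fun a => u t θ (φ (θ, a))).2
        have h2 := (sum_mul_mem_unitInterval (π t θ) (u t θ)).1
        linarith
    _ = T := by
        have h : ∑ θ, ρ θ = 1 := ρ.2.2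
        simp [h]

lemma integrable_untruthfulSwapRegret [Nonempty Θ] [Nonempty A] {T : ℕ} {Ω : Type*}
    [MeasurableSpace Ω] (R : RandomizedAlgorithm Ω Θ A T) (ρ : stdSimplex ℝ Θ)
    (u : Fin T → RewardVector Θ A) :
    Integrable (fun ω => untruthfulSwapRegret ρ ((R.det ω).decisions u) u) R.law := by
  have := R.isProbabilityMeasure
  refine Integrable.of_bound (Measurable.aestronglyMeasurable ?_) T
    (Filter.Eventually.of_forall fun ω => ?_)
  · unfold untruthfulSwapRegret
    refine Measurable.iSup fun ψ => Measurable.iSup fun φ => ?_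
    refine Finset.measurable_sum _ fun t _ => Finset.measurable_sum _ fun θ _ => ?_
    refine Measurable.const_mul (Measurable.sub ?_ ?_) _ <;>
      exact Finset.measurable_sum _ fun a _ => (R.measurable_det t _ _ a).mul_const _
  · rw [Real.norm_of_nonneg (untruthfulSwapRegret_nonneg _ _ _)]
    exact untruthfulSwapRegret_le _ _ _

/-- As the regret is a maximum of linear functions of the decisions, its expectation is bounded
below by the gain of every deviation from the mean decisions. -/
lemma sum_le_expectedRegret [Nonempty Θ] {T : ℕ} {Ω : Type*} [MeasurableSpace Ω]
    (R : RandomizedAlgorithm Ω Θ A T) (e : A ≃ Bool) {G : Fin T → Θ → ℝ}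
    (hG : ∀ t θ, |G t θ| ≤ 1) (κ : Θ → Option Bool) (ψ : Θ → Θ) :
    ∑ t, ∑ θ, G t θ * (deviation κ ψ (meanAdvantage R e (rewardOfGain e G) t) θ -
      meanAdvantage R e (rewardOfGain e G) t θ) ≤
      2 * Fintype.card Θ * R.expectedRegret stdSimplex.barycenter (rewardOfGain e G) := by
  have := R.isProbabilityMeasure
  have : Nonempty A := ⟨e.symm true⟩
  set u := rewardOfGain e G with hu
  set x : Ω → Fin T → Θ → ℝ := fun ω t θ => advantage e ((R.det ω).decisions u t θ) with hx
  have hN : (0 : ℝ) < Fintype.card Θ := by exact_mod_cast Fintype.card_pos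
  have hpt : ∀ ω, ∑ t, ∑ θ, G t θ * (deviation κ ψ (x ω t) θ - x ω t θ) ≤
      2 * Fintype.card Θ *
        untruthfulSwapRegret stdSimplex.barycenter ((R.det ω).decisions u) u := fun ω => by
    have h := le_untruthfulSwapRegret stdSimplex.barycenter ((R.det ω).decisions u) u ψ
      (fun q => (κ q.1).elim q.2 e.symm)
    refine le_trans (le_of_eq ?_) (mul_le_mul_of_nonneg_left h (by positivity))
    simp only [Finset.mul_sum]
    refine Finset.sum_congr rfl fun t _ => Finset.sum_congr rfl fun θ _ => ?_
    have hbar : (stdSimplex.barycenter : stdSimplex ℝ Θ) θ = (Fintype.card Θ : ℝ)⁻¹ := rfl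
    simp only [hu, coe_rewardOfGain e hG, hbar]
    rw [sum_mul_gain e ((R.det ω).decisions (rewardOfGain e G) t θ)]
    rcases hκ : κ θ with _ | b
    · simp only [deviation, hκ, Option.elim_none]
      rw [sum_mul_gain]
      simp only [hx, hu]
      field_simp
      ring
    · simp only [deviation, hκ, Option.elim_some, Equiv.apply_symm_apply]
      rw [← Finset.sum_mul,
        show ∑ a, (R.det ω).decisions (rewardOfGain e G) t (ψ θ) a = 1 from
          ((R.det ω).decisions (rewardOfGain e G) t (ψ θ)).2.2]
      simp only [hx, hu]
      field_simp
      ring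
  have hdev : ∀ t θ, Integrable (fun ω => deviation κ ψ (x ω t) θ) R.law ∧
      ∫ ω, deviation κ ψ (x ω t) θ ∂(R.law) = deviation κ ψ (meanAdvantage R e u t) θ :=
    fun t θ => by
      rcases hκ : κ θ with _ | b
      · simp only [deviation, hκ, Option.elim_none]
        exact ⟨integrable_advantage R e u t _, rfl⟩
      · simp only [deviation, hκ, Option.elim_some]
        exact ⟨integrable_const _, by simp⟩
  have hint : ∀ t θ, Integrable (fun ω => G t θ * (deviation κ ψ (x ω t) θ - x ω t θ)) R.law :=
    fun t θ => ((hdev t θ).1.sub (integrable_advantage R e u t θ)).const_mul _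
  have h := integral_mono
    (integrable_finsetSum _ fun t _ => integrable_finsetSum _ fun θ _ => hint t θ)
    ((integrable_untruthfulSwapRegret R stdSimplex.barycenter u).const_mul
      (2 * (Fintype.card Θ : ℝ))) hpt
  rw [integral_const_mul, integral_finsetSum _ fun t _ =>
    integrable_finsetSum _ fun θ _ => hint t θ] at h
  refine le_trans (le_of_eq (Finset.sum_congr rfl fun t _ => ?_)) h
  rw [integral_finsetSum _ fun θ _ => hint t θ]
  refine Finset.sum_congr rfl fun θ _ => ?_
  rw [integral_const_mul, integral_sub (hdev t θ).1 (integrable_advantage R e u t θ), (hdev t θ).2]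
  rfl

end Game

/-! ### Blocks of equal length and constants -/

lemma card_filter_divNat {B L : ℕ} (k : Fin B) :
    (Finset.univ.filter fun t : Fin (B * L) => t.divNat = k).card = L := by
  have h : (Finset.univ.filter fun t : Fin (B * L) => t.divNat = k) =
      (Finset.univ : Finset (Fin L)).map
        ⟨fun j => finProdFinEquiv (k, j), fun i j hij => by simpa using hij⟩ := by
    ext t
    simp only [Finset.mem_filter, Finset.mem_univ, true_and, Finset.mem_map]
    constructor
    · rintro rfl
      exact ⟨t.modNat, finProdFinEquiv.apply_symm_apply t⟩
    · rintro ⟨j, rfl⟩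
      exact congrArg Prod.fst (finProdFinEquiv.symm_apply_apply (k, j))
  rw [h, Finset.card_map, Finset.card_univ, Fintype.card_fin]

lemma one_add_sq_pow_le {L : ℕ} (hL : 0 < L) :
    (1 + (1 / (16 * Real.sqrt L)) ^ 2) ^ (2 * L) ≤ 1 + (1 / 8 : ℝ) ^ 2 := by
  have hL' : (0 : ℝ) < L := by exact_mod_cast hL
  have e : (1 / (16 * Real.sqrt L)) ^ 2 = 1 / (256 * (L : ℝ)) := by
    rw [div_pow, mul_pow, Real.sq_sqrt hL'.le]
    norm_num
  rw [e]
  calc (1 + 1 / (256 * (L : ℝ))) ^ (2 * L)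
      ≤ (Real.exp (1 / (256 * (L : ℝ)))) ^ (2 * L) := by
        gcongr
        linarith [Real.add_one_le_exp (1 / (256 * (L : ℝ)))]
    _ = Real.exp (1 / 128) := by
        rw [← Real.exp_nat_mul]
        congr 1
        push_cast
        field_simp
        norm_num
    _ ≤ _ := by
        have h := Real.abs_exp_sub_one_le (x := 1 / 128) (by norm_num [abs_of_pos])
        rw [abs_of_pos (by norm_num : (0 : ℝ) < 1 / 128)] at h
        linarith [le_abs_self (Real.exp (1 / 128) - 1)]

/-- An average regret below `r` is incompatible with the conclusion of `le_of_deviations_le`, for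
the bias `1 / (16 √L)`. The factor `2 * N` comes from the average over the `N` types and from the
advantage of a decision being twice the deviation of its probability from `1/2`. The lower bound on
the horizon gives `N * r ≤ T / 8`, which is what the doubling of the gains costs. -/
lemma not_deviations_bound {B L : ℕ} (hB : 0 < B) (hL : 0 < L) {N r : ℝ}
    (hN : N = 2 ^ (B + 1)) (hT : (2 : ℝ) ^ (-49 : ℤ) * N ^ 2 * (B + 1) ≤ B * L)
    (hr : r = (2 : ℝ) ^ (-28 : ℤ) * Real.sqrt (B * L * (B + 1))) :
    2 * N * r < 1 / (16 * Real.sqrt L) *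
      (2 ^ B * (B * L) / 2 - 2 ^ (B - 1) * (2 * N * r) - 1 / 8 * 2 ^ B * (B * L)) := by
  have hB' : (1 : ℝ) ≤ B := by exact_mod_cast hB
  have hL' : (1 : ℝ) ≤ L := by exact_mod_cast hL
  have hr0 : 0 ≤ r := hr ▸ by positivity
  have hr2 : r ^ 2 = (2 : ℝ) ^ (-56 : ℤ) * (B * L * (B + 1)) := by
    rw [hr, mul_pow, Real.sq_sqrt (by positivity)]
    norm_num
  have hN0 : 0 < N := hN ▸ by positivity
  have h1 : N * r ≤ B * L / 8 := by
    refine abs_le_of_sq_le_sq' ?_ (by positivity) |>.2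
    rw [mul_pow, hr2]
    norm_num at hT ⊢
    nlinarith [mul_le_mul_of_nonneg_left hT (by positivity : (0 : ℝ) ≤ B * L)]
  have hpow : (2 : ℝ) ^ B = 2 * 2 ^ (B - 1) := by
    rw [← pow_succ']
    congr 1
    omega
  have hN2 : N = 2 * 2 ^ B := by rw [hN, pow_succ']
  have h2 : 4 * r < 1 / (16 * Real.sqrt L) * (B * L / 4) := by
    refine lt_of_pow_lt_pow_left₀ 2 (by positivity) ?_
    rw [mul_pow, mul_pow, hr2, div_pow, mul_pow, Real.sq_sqrt (by positivity), one_pow,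
      div_pow, mul_pow, div_mul_div_comm, lt_div_iff₀ (by positivity)]
    norm_num
    have : (0 : ℝ) < B * L ^ 2 := by positivity
    nlinarith [mul_le_mul_of_nonneg_left hB' this.le]
  have h3 : 0 < 1 / (16 * Real.sqrt L) := by positivity
  calc 2 * N * r = 2 ^ B * (4 * r) := by rw [hN2]; ring
    _ < 2 ^ B * (1 / (16 * Real.sqrt L) * (B * L / 4)) := by gcongr
    _ ≤ 2 ^ B * (1 / (16 * Real.sqrt L) * (3 / 8 * (B * L) - N * r)) := by
        gcongr
        linarith
    _ = _ := by rw [hpow]; ring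

/-- The lower bound for `2 ^ (B + 1)` types with `B ≥ 1` and `B` blocks of length `L ≥ 1`. -/
lemma exists_le_expectedRegret {Θ A : Type*} [Fintype Θ] [Nonempty Θ] [Fintype A] {B L : ℕ}
    (hB : 0 < B) (hL : 0 < L) (hA : Fintype.card A = 2) (hΘ : Fintype.card Θ = 2 ^ (B + 1))
    (hT : (2 : ℝ) ^ (-49 : ℤ) * (Fintype.card Θ : ℝ) ^ 2 * (B + 1) ≤ B * L)
    {Ω : Type*} [MeasurableSpace Ω] (R : RandomizedAlgorithm Ω Θ A (B * L)) :
    ∃ u : Fin (B * L) → RewardVector Θ A,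
      (2 : ℝ) ^ (-28 : ℤ) * Real.sqrt (B * L * (B + 1)) ≤
        R.expectedRegret stdSimplex.barycenter u := by
  by_contra! hcon
  set r : ℝ := (2 : ℝ) ^ (-28 : ℤ) * Real.sqrt (B * L * (B + 1)) with hr
  have e : A ≃ Bool := Fintype.equivOfCardEq (by simpa using hA)
  have f : Θ ≃ (Fin B → Bool) ⊕ (Fin B → Bool) := Fintype.equivOfCardEq (by
    simp [hΘ, pow_succ]; ring)
  set U : (Fin (B * L) → (Fin B → Bool) ⊕ (Fin B → Bool) → ℝ) →
    Fin (B * L) → RewardVector Θ A := fun G => rewardOfGain e fun t θ => G t (f θ) with hU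
  have hdev : ∀ G : Fin (B * L) → (Fin B → Bool) ⊕ (Fin B → Bool) → ℝ, (∀ t x, |G t x| ≤ 1) →
      ∀ (κ : (Fin B → Bool) ⊕ (Fin B → Bool) → Option Bool)
        (ψ : (Fin B → Bool) ⊕ (Fin B → Bool) → (Fin B → Bool) ⊕ (Fin B → Bool)),
      ∑ x, ∑ t, G t x * (deviation κ ψ (fun y => meanAdvantage R e (U G) t (f.symm y)) x -
        meanAdvantage R e (U G) t (f.symm x)) ≤ 2 * Fintype.card Θ * r := by
    intro G hG κ ψ
    have h := sum_le_expectedRegret R e (G := fun t θ => G t (f θ)) (fun t θ => hG t _)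
      (fun θ => κ (f θ)) (fun θ => f.symm (ψ (f θ)))
    rw [Finset.sum_comm, ← Equiv.sum_comp f.symm] at h
    simp only [deviation, Equiv.apply_symm_apply] at h
    exact h.trans (mul_le_mul_of_nonneg_left (hcon _).le (by positivity))
  have hcore := le_of_deviations_le (R := 2 * Fintype.card Θ * r) hB
    (blk := fun t : Fin (B * L) => t.divNat)
    (fun s t hst => Nat.div_le_div_right hst) card_filter_divNat
    (Z := fun G t x => meanAdvantage R e (U G) t (f.symm x))
    (fun G G' t h => funext fun x => meanAdvantage_congr R e (fun s hs => by
      funext θ a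
      simp only [hU, rewardOfGain, h s hs]) _)
    (fun G t x => abs_meanAdvantage_le_one R e _ t _)
    (fun G hG s => by
      simpa [Fintype.sum_sum_type, deviation] using
        hdev G hG (Sum.elim (fun b => some (s b)) fun _ => none) id)
    (fun G hG σ => by
      simpa [Fintype.sum_sum_type, deviation] using
        hdev G hG (fun _ => none) (Sum.elim Sum.inl fun w => Sum.inl (σ w)))
    (δ := 1 / (16 * Real.sqrt L)) (by positivity)
    (by
      have h1 : (1 : ℝ) ≤ Real.sqrt L := Real.one_le_sqrt.2 (by exact_mod_cast hL)
      rw [div_le_one (by positivity)]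
      linarith)
    (ε := 1 / 8) (by norm_num) (one_add_sq_pow_le hL)
  push_cast at hcore
  exact absurd hcore (not_le.2 (not_deviations_bound hB hL (by exact_mod_cast hΘ) hT hr))

end

theorem theorem4p1 {Θ A : Type*} [Fintype Θ] [Nonempty Θ] [Fintype A] (B : ℤ) (T : ℕ)
    (hA : Fintype.card A = 2)
    (hΘ : (Fintype.card Θ : ℝ) = (2 : ℝ) ^ (B + 1))
    (hB : B ∣ (T : ℤ))
    (hT : (2 : ℝ) ^ (-49 : ℤ) * (Fintype.card Θ : ℝ) ^ 2 * Real.logb 2 (Fintype.card Θ)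
      ≤ (T : ℝ))
    {Ω : Type*} [MeasurableSpace Ω] (R : RandomizedAlgorithm Ω Θ A T) :
    ∃ u : Fin T → RewardVector Θ A,
      (2 : ℝ) ^ (-28 : ℤ) * Real.sqrt (T * Real.logb 2 (Fintype.card Θ))
        ≤ R.expectedRegret stdSimplex.barycenter u := by
  have hlog : Real.logb 2 (Fintype.card Θ) = B + 1 := by
    rw [hΘ, ← Real.rpow_intCast, Real.logb_rpow (by norm_num) (by norm_num)]
    push_cast
    rfl
  have hcard : (0 : ℝ) < Fintype.card Θ := by exact_mod_cast Fintype.card_pos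
  have hlog0 : (0 : ℝ) ≤ B + 1 := hlog ▸ Real.logb_nonneg (by norm_num)
    (by exact_mod_cast Fintype.card_pos (α := Θ))
  have hB1 : -1 ≤ B := by
    have : (0 : ℤ) ≤ B + 1 := by exact_mod_cast hlog0
    omega
  rw [hlog] at hT ⊢
  -- For `B = -1` there is one type and the bound is zero; `B = 0` would force `T = 0`, which the
  -- lower bound for `T` excludes.
  rcases hB1.eq_or_lt with rfl | hB1
  · refine ⟨fun _ _ _ => 0, ?_⟩
    have h : 0 ≤ R.expectedRegret stdSimplex.barycenter (fun _ _ _ => 0) :=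
      integral_nonneg fun ω => untruthfulSwapRegret_nonneg _ _ _
    simpa using h
  lift B to ℕ using by omega with n
  have hTpos : 0 < T := by
    have h : (0 : ℝ) < T := lt_of_lt_of_le (by positivity) hT
    exact_mod_cast h
  obtain ⟨L, rfl⟩ := Int.natCast_dvd_natCast.1 hB
  have hn := Nat.pos_of_mul_pos_right hTpos
  have hL := Nat.pos_of_mul_pos_left hTpos
  push_cast at hT ⊢
  exact exists_le_expectedRegret hn hL hA (by exact_mod_cast hΘ) hT R
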